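/- Let $R$ be a commutative noetherian local ring with maximal ideal $\mathfrak m = I\oplus J$ (that is, $I+J=\mathfrak m$ and $I\cap J=0$), where $I$ and $J$ are nonzero ideals of $R$. For a nonzero finitely generated $R$-module $M$, let $\operatorname{depth} M$ be the supremum of the lengths of the $M$-regular sequences in $\mathfrak m$. Let $\mathsf{Syz}_0(R)$ be the class of all finitely generated $R$-modules, and for $n\ge 1$ let $\mathsf{Syz}_n(R)$ be the class of all finitely generated $R$-modules $M$ that fit into an exact sequence $0\to M\to P\to N\to 0$ with $P$ a finitely generated projective $R$-module and $N\in\mathsf{Syz}_{n-1}(R)$. A class $\mathcal X$ of finitely generated $R$-modules is closed under direct summands if every $R$-module isomorphic to a direct summand of a module in $\mathcal X$ belongs to $\mathcal X$. (1) If $\operatorname{depth} R/I=0$ and $\operatorname{depth} R/J\ge 1$, then $\operatorname{depth} R=0$, and $\mathsf{Syz}_n(R)$ is not closed under direct summands for every $n\ge 2$. (2) If $I$ is indecomposable as an $R$-module and $\operatorname{depth} R/I\ge 2$, then $\operatorname{depth} R\le 1$, and $\mathsf{Syz}_n(R)$ is not closed under direct summands for every $n\ge 4$. -/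

import Mathlib

open CategoryTheory

universe u

/-- The depth of a module `M` over a local ring `R`: the supremum of the lengths of the
`M`-regular sequences contained in the maximal ideal of `R`. It is used for nonzero finitely
generated modules over noetherian local rings only. -/
noncomputable def moduleDepth (R : Type*) [CommRing R] [IsLocalRing R]
    (M : Type*) [AddCommGroup M] [Module R M] : ℕ∞ :=
  ⨆ rs ∈ {rs : List R | (∀ r ∈ rs, r ∈ IsLocalRing.maximalIdeal R) ∧
    RingTheory.Sequence.IsRegular M rs}, (rs.length : ℕ∞)

/-- `ΩX` for a class `X` of modules: the finitely generated modules `M` that fit into an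
exact sequence `0 → M → P → N → 0` with `P` finitely generated projective and `N` in `X`. -/
def syzygyClass (R : Type u) [CommRing R] (X : ObjectProperty (ModuleCat.{u} R)) :
    ObjectProperty (ModuleCat.{u} R) := fun M =>
  Module.Finite R M ∧ ∃ (P N : ModuleCat.{u} R) (f : M →ₗ[R] P) (g : P →ₗ[R] N),
    Module.Finite R P ∧ Module.Projective R P ∧ X N ∧
    Function.Injective f ∧ Function.Exact f g ∧ Function.Surjective g

/-- `Syz_n(R) = Ωⁿ(mod R)`, the class of `n`-syzygy modules, where `mod R` is the class of
finitely generated `R`-modules. -/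
def Syz (R : Type u) [CommRing R] : ℕ → ObjectProperty (ModuleCat.{u} R)
  | 0 => fun M => Module.Finite R M
  | n + 1 => syzygyClass R (Syz R n)

/-- A class `X` of modules is closed under direct summands: if `M` is in `X` and `N` is
isomorphic to a direct summand of `M`, then `N` is in `X`. -/
def ClosedUnderDirectSummands (R : Type u) [CommRing R]
    (X : ObjectProperty (ModuleCat.{u} R)) : Prop :=
  ∀ M N L : ModuleCat.{u} R, X M → Nonempty (M ≃ₗ[R] (N × L)) → X N

/-! Since `I * J = 0`, relations on `J` see `I`: in a relation among generators of `J`, the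
coefficient of a generator outside a maximal submodule lies in `𝔪 = I ⊕ J`, and `I` kills that
generator, so `I` splits off the syzygy. Hence, once `I` and `J` are both summands of second
syzygies, they are summands of `n`-th syzygies for all `n ≥ 2` (`IsSummandOfSyz.of_two_le`). It
remains to show that they cannot all be syzygies themselves.

(1) The `J`-component `s` of a lifted socle element of `R ⧸ I` is a nonzero socle element of `R`,
and `𝔪 ≅ I × J` is the kernel of multiplication by `s`, a second syzygy. But `I` has zero socle, and
over a ring with nonzero socle a second syzygy with zero socle vanishes (`Syz.eq_zero_of_socle`).

(2) If `R ⧸ J` has depth zero, (1) applies with the roles exchanged. Otherwise `I` and `J` are each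
other's annihilators, hence second syzygies. Suppose both are in `Syz R 4`. Depth at least two of `R
⧸ I` makes every map `J → R` a homothety, so an embedding of `J` in a free module is `y ↦ y • v`
with `v` unimodular, and `R ⧸ J` is a third syzygy (`syz_quotient_of_syz`). This forces `I` to be
principal with `I ≅ R ⧸ J` (`exists_generator_of_syz_quotient`); now `R ⧸ J` is a fourth syzygy, so
`R ⧸ I` is a third one and `J` is principal too. A principal `J` cannot contain a regular pair on `R
⧸ I`. -/

section Depth

/-! ### Depth, regular elements and socles. -/

open RingTheory.Sequence IsLocalRing

variable {R : Type*} [CommRing R] [IsLocalRing R]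

lemma exists_isRegular_of_lt_moduleDepth {M : Type*} [AddCommGroup M] [Module R M] {n : ℕ}
    (h : (n : ℕ∞) < moduleDepth R M) :
    ∃ rs : List R, (∀ r ∈ rs, r ∈ maximalIdeal R) ∧ IsRegular M rs ∧ n < rs.length := by
  obtain ⟨rs, h⟩ := lt_iSup_iff.1 h
  obtain ⟨hrs, h⟩ := lt_iSup_iff.1 h
  exact ⟨rs, hrs.1, hrs.2, by exact_mod_cast h⟩

lemma exists_isSMulRegular_of_one_le_moduleDepth {M : Type*} [AddCommGroup M] [Module R M]
    (h : 1 ≤ moduleDepth R M) : ∃ a ∈ maximalIdeal R, IsSMulRegular M a := by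
  obtain ⟨rs, hm, hreg, hlen⟩ := exists_isRegular_of_lt_moduleDepth (n := 0)
    (lt_of_lt_of_le (by simp) h)
  match rs with
  | a :: rs =>
    exact ⟨a, hm a (by simp), ((isRegular_cons_iff M a rs).1 hreg).1⟩

lemma exists_isSMulRegular_of_two_le_moduleDepth {M : Type*} [AddCommGroup M] [Module R M]
    (h : 2 ≤ moduleDepth R M) : ∃ a ∈ maximalIdeal R, ∃ b ∈ maximalIdeal R,
      IsSMulRegular M a ∧ IsSMulRegular (QuotSMulTop a M) b := by
  obtain ⟨rs, hm, hreg, hlen⟩ := exists_isRegular_of_lt_moduleDepth (n := 1) (R := R) (M := M)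
    (lt_of_lt_of_le (by norm_num) h)
  match rs with
  | a :: b :: rs =>
    obtain ⟨h1, h2⟩ := (isRegular_cons_iff M a _).1 hreg
    exact ⟨a, hm a (by simp), b, hm b (by simp), h1, ((isRegular_cons_iff _ b rs).1 h2).1⟩

lemma one_le_moduleDepth [IsNoetherianRing R] {M : Type*} [AddCommGroup M] [Module R M]
    [Module.Finite R M] [Nontrivial M] {a : R} (ha : a ∈ maximalIdeal R)
    (h : IsSMulRegular M a) : 1 ≤ moduleDepth R M := by
  have hreg : IsRegular M [a] := by
    rw [isRegular_iff]
    refine ⟨(isWeaklyRegular_singleton_iff M a).2 h, ?_⟩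
    rw [Ideal.ofList_singleton]
    refine Submodule.top_ne_ideal_smul_of_le_jacobson_annihilator ?_
    refine le_trans ?_ (maximalIdeal_le_jacobson _)
    rwa [Ideal.span_singleton_le_iff_mem]
  exact le_trans (by simp) (le_iSup₂_of_le (f := fun (rs : List R) (_ : rs ∈ {rs : List R |
    (∀ r ∈ rs, r ∈ maximalIdeal R) ∧ IsRegular M rs}) => (rs.length : ℕ∞)) [a]
    ⟨by simpa using ha, hreg⟩ le_rfl)

/-- A finitely generated module of depth zero has a nonzero socle. -/
lemma exists_socle_of_moduleDepth_eq_zero [IsNoetherianRing R] {M : Type*} [AddCommGroup M]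
    [Module R M] [Module.Finite R M] [Nontrivial M] (h : moduleDepth R M = 0) :
    ∃ x : M, x ≠ 0 ∧ ∀ a ∈ maximalIdeal R, a • x = 0 := by
  have hsub : (maximalIdeal R : Set R) ⊆ ⋃ p ∈ associatedPrimes R M, (p : Set R) := by
    intro a ha
    rw [biUnion_associatedPrimes_eq_compl_regular]
    intro hreg
    have := one_le_moduleDepth ha hreg
    simp [h] at this
  -- Prime avoidance; the two `⊥` fill the slots of the ideals allowed to be non-prime, and none is
  -- needed.
  obtain ⟨p, hp, hle⟩ := (Ideal.subset_union_prime_finite (associatedPrimes.finite R M)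
    (f := id) ⊥ ⊥ (fun _ h _ _ ↦ h.1)).1 hsub
  rw [AssociatedPrimes.mem_iff, isAssociatedPrime_iff] at hp
  obtain ⟨hp, x, rfl⟩ := hp
  refine ⟨x, ?_, fun a ha ↦ ?_⟩
  · rintro rfl
    exact hp.ne_top (by simp)
  · have := hle ha
    simpa using this

/-- The ideal `I` is saturated with respect to the maximal ideal: `R ⧸ I` has zero socle. -/
def Ideal.IsMaxSaturated (I : Ideal R) : Prop :=
  ∀ r, (∀ a ∈ maximalIdeal R, a * r ∈ I) → r ∈ I

lemma Ideal.isMaxSaturated_of_one_le_moduleDepth {I : Ideal R} (h : 1 ≤ moduleDepth R (R ⧸ I)) :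
    I.IsMaxSaturated := by
  obtain ⟨a, ha, hreg⟩ := exists_isSMulRegular_of_one_le_moduleDepth h
  intro r hr
  rw [← Ideal.Quotient.eq_zero_iff_mem]
  refine hreg.right_eq_zero_of_smul ?_
  rw [← Ideal.Quotient.mk_eq_mk, ← Submodule.Quotient.mk_smul, Ideal.Quotient.mk_eq_mk,
    Ideal.Quotient.eq_zero_iff_mem]
  exact hr a ha

/-- If `M` has nonzero socle, then its depth is zero. -/
lemma moduleDepth_eq_zero_of_socle {M : Type*} [AddCommGroup M] [Module R M] {x : M}
    (hx : x ≠ 0) (h : ∀ a ∈ maximalIdeal R, a • x = 0) : moduleDepth R M = 0 := by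
  by_contra hne
  obtain ⟨a, ha, hreg⟩ := exists_isSMulRegular_of_one_le_moduleDepth
    (Order.one_le_iff_ne_zero.2 hne)
  exact hx (hreg.right_eq_zero_of_smul (h a ha))

end Depth

/-! ### Consequences of the decomposition `𝔪 = I ⊕ J`. -/

section Decomposition

open IsLocalRing

variable {R : Type*} [CommRing R] {I J : Ideal R}

lemma Ideal.mul_eq_zero_of_inf_eq_bot (hinf : I ⊓ J = ⊥) {i j : R} (hi : i ∈ I) (hj : j ∈ J) :
    i * j = 0 := by
  have : i * j ∈ I ⊓ J := ⟨I.mul_mem_right _ hi, J.mul_mem_left _ hj⟩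
  rwa [hinf] at this

lemma Ideal.eq_zero_of_mem_of_inf_eq_bot (hinf : I ⊓ J = ⊥) {i : R} (hi : i ∈ I) (hj : i ∈ J) :
    i = 0 := by
  have : i ∈ I ⊓ J := ⟨hi, hj⟩
  rwa [hinf] at this

/-- If `J` contains a regular sequence of length two on `R ⧸ I`, every linear map `J → R` is a homothety. -/
lemma exists_eq_mul_of_regular_pair (hinf : I ⊓ J = ⊥)
    {a b : R} (ha : a ∈ J) (hb : b ∈ J) (hreg : ∀ r, a * r ∈ I → r ∈ I)
    (hreg' : ∀ r s, b * r - a * s ∈ I → ∃ t, r - a * t ∈ I)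
    (hannI : ∀ r, (∀ i ∈ I, i * r = 0) → r ∈ J) (φ : J →ₗ[R] R) :
    ∃ s, ∀ y : J, φ y = y * s := by
  have hcomm : ∀ y z : J, (y : R) * φ z = z * φ y := by
    intro y z
    rw [← smul_eq_mul, ← smul_eq_mul, ← map_smul, ← map_smul]
    congr 1
    exact Subtype.ext (mul_comm _ _)
  have hmem : ∀ y : J, φ y ∈ J := by
    intro y
    refine hannI _ fun i hi ↦ ?_
    rw [← smul_eq_mul, ← map_smul]
    convert map_zero φ
    exact Subtype.ext (Ideal.mul_eq_zero_of_inf_eq_bot hinf hi y.2)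
  -- From `b * φ a = a * φ b`, regularity of the pair gives `φ a ≡ a * s` modulo `I`. Multiplying by
  -- `y` and cancelling `a` puts `φ y - y * s` in `I`, while it also lies in `J`.
  obtain ⟨s, hs⟩ := hreg' (φ ⟨a, ha⟩) (φ ⟨b, hb⟩) (by
    rw [hcomm ⟨b, hb⟩ ⟨a, ha⟩, sub_self]; exact I.zero_mem)
  refine ⟨s, fun y ↦ ?_⟩
  rw [← sub_eq_zero]
  refine Ideal.eq_zero_of_mem_of_inf_eq_bot hinf (hreg _ ?_)
    (J.sub_mem (hmem y) (J.mul_mem_right _ y.2))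
  rw [show a * (φ y - y * s) = y * (φ ⟨a, ha⟩ - a * s) by
    linear_combination hcomm ⟨a, ha⟩ y]
  exact I.mul_mem_left _ hs

variable [IsLocalRing R]

/-- For a regular pair `x = i + j`, `y = i' + j'`, the relation `y * i = i * i' = x * i'` forces `i
= x * t`, so `i * (1 - t) = j * t` lies in `I ⊓ J` and vanishes. As `t` or `1 - t` is a unit, `x`
lies in `I` or in `J` and kills the other ideal. -/
lemma moduleDepth_le_one_of_maximalIdeal_eq_sup (hI : I ≠ ⊥) (hJ : J ≠ ⊥)
    (hsum : I ⊔ J = maximalIdeal R) (hinf : I ⊓ J = ⊥) : moduleDepth R R ≤ 1 := by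
  by_contra hlt
  have h2 : 2 ≤ moduleDepth R R := by
    rw [not_le] at hlt
    have := Order.add_one_le_of_lt hlt
    rwa [one_add_one_eq_two] at this
  obtain ⟨x, hx, y, hy, hxreg, hyreg⟩ := exists_isSMulRegular_of_two_le_moduleDepth h2
  have hxr : ∀ r : R, x * r = 0 → r = 0 := fun r h ↦ hxreg.right_eq_zero_of_smul h
  have hyr : ∀ r s : R, y * r = x * s → ∃ t, r = x * t := by
    intro r s h
    have h0 : (Submodule.Quotient.mk r : QuotSMulTop x R) = 0 := by
      refine hyreg.right_eq_zero_of_smul ?_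
      rw [← Submodule.Quotient.mk_smul, Submodule.Quotient.mk_eq_zero]
      exact (Submodule.mem_smul_pointwise_iff_exists _ _ _).2 ⟨s, trivial, h.symm⟩
    rw [Submodule.Quotient.mk_eq_zero] at h0
    obtain ⟨t, -, ht⟩ := (Submodule.mem_smul_pointwise_iff_exists _ _ _).1 h0
    exact ⟨t, ht.symm⟩
  rw [← hsum] at hx hy
  obtain ⟨i, hi, j, hj, rfl⟩ := Submodule.mem_sup.1 hx
  obtain ⟨i', hi', j', hj', rfl⟩ := Submodule.mem_sup.1 hy
  obtain ⟨t, ht⟩ := hyr i i' (by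
    linear_combination Ideal.mul_eq_zero_of_inf_eq_bot hinf hi hj' -
      Ideal.mul_eq_zero_of_inf_eq_bot hinf hi' hj)
  have hit : i * (1 - t) = 0 := Ideal.eq_zero_of_mem_of_inf_eq_bot hinf
    (I.mul_mem_right _ hi) (by
      rw [show i * (1 - t) = j * t by linear_combination ht]; exact J.mul_mem_right _ hj)
  have hjt : j * t = 0 := by linear_combination hit - ht
  obtain ⟨p, hp, hp0⟩ := Submodule.exists_mem_ne_zero_of_ne_bot hI
  obtain ⟨q, hq, hq0⟩ := Submodule.exists_mem_ne_zero_of_ne_bot hJ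
  rcases isUnit_or_isUnit_one_sub_self t with hu | hu
  · have : j = 0 := by rwa [hu.mul_left_eq_zero] at hjt
    refine hq0 (hxr q ?_)
    rw [this, add_zero]
    exact Ideal.mul_eq_zero_of_inf_eq_bot hinf hi hq
  · have : i = 0 := by rwa [hu.mul_left_eq_zero] at hit
    refine hp0 (hxr p ?_)
    rw [this, zero_add, mul_comm]
    exact Ideal.mul_eq_zero_of_inf_eq_bot hinf hp hj

/-- An ideal `I` with `depth R ⧸ I ≥ 2` contains a complement `J` in `𝔪` with elements
that form a regular sequence on `R ⧸ I`. -/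
lemma exists_regular_pair_of_two_le_moduleDepth (hsum : I ⊔ J = maximalIdeal R)
    (h : 2 ≤ moduleDepth R (R ⧸ I)) :
    ∃ a ∈ J, ∃ b ∈ J, (∀ r, a * r ∈ I → r ∈ I) ∧
      ∀ r s, b * r - a * s ∈ I → ∃ t, r - a * t ∈ I := by
  obtain ⟨x, hx, y, hy, hxreg, hyreg⟩ := exists_isSMulRegular_of_two_le_moduleDepth h
  rw [← hsum] at hx hy
  obtain ⟨i, hi, a, ha, rfl⟩ := Submodule.mem_sup.1 hx
  obtain ⟨i', hi', b, hb, rfl⟩ := Submodule.mem_sup.1 hy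
  -- The `I`-components act as zero on `R ⧸ I`, so the `J`-components remain a regular pair.
  refine ⟨a, ha, b, hb, fun r hr ↦ ?_, fun r s hrs ↦ ?_⟩
  · rw [← Ideal.Quotient.eq_zero_iff_mem]
    refine hxreg.right_eq_zero_of_smul ?_
    rw [← Ideal.Quotient.mk_eq_mk, ← Submodule.Quotient.mk_smul, Ideal.Quotient.mk_eq_mk,
      Ideal.Quotient.eq_zero_iff_mem, smul_eq_mul, add_mul]
    exact I.add_mem (I.mul_mem_right _ hi) hr
  · have h0 : (Submodule.Quotient.mk (Ideal.Quotient.mk I r) :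
        QuotSMulTop (i + a) (R ⧸ I)) = 0 := by
      refine hyreg.right_eq_zero_of_smul ?_
      rw [← Submodule.Quotient.mk_smul, Submodule.Quotient.mk_eq_zero]
      refine (Submodule.mem_smul_pointwise_iff_exists _ _ _).2 ⟨Ideal.Quotient.mk I s, trivial, ?_⟩
      rw [Algebra.smul_def, Algebra.smul_def, Ideal.Quotient.algebraMap_eq, ← map_mul, ← map_mul,
        Ideal.Quotient.eq]
      rw [show (i + a) * s - (i' + b) * r = i * s - i' * r - (b * r - a * s) by ring]
      exact I.sub_mem (I.sub_mem (I.mul_mem_right _ hi) (I.mul_mem_right _ hi')) hrs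
    rw [Submodule.Quotient.mk_eq_zero] at h0
    obtain ⟨t, -, ht⟩ := (Submodule.mem_smul_pointwise_iff_exists _ _ _).1 h0
    obtain ⟨t, rfl⟩ := Ideal.Quotient.mk_surjective t
    rw [Algebra.smul_def, Ideal.Quotient.algebraMap_eq, ← map_mul, eq_comm,
      Ideal.Quotient.eq] at ht
    refine ⟨t, ?_⟩
    rw [show r - a * t = r - (i + a) * t + i * t by ring]
    exact I.add_mem ht (I.mul_mem_right _ hi)

end Decomposition

/-! ### Formal properties of syzygy classes. -/

section SyzygyBasics

variable {R : Type u} [CommRing R]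

lemma Syz.of_equiv {n : ℕ} {M N : Type u} [AddCommGroup M] [Module R M] [AddCommGroup N]
    [Module R N] (e : M ≃ₗ[R] N) (h : Syz R n (ModuleCat.of R M)) :
    Syz R n (ModuleCat.of R N) := by
  cases n with
  | zero =>
    have : Module.Finite R M := h
    exact Module.Finite.equiv e
  | succ n =>
    obtain ⟨hM, P, L, f, g, hP, hP', hL, hf, hfg, hg⟩ := h
    have : Module.Finite R M := hM
    refine ⟨Module.Finite.equiv e, P, L, f ∘ₗ e.symm.toLinearMap, g, hP, hP', hL,
      hf.comp e.symm.injective, ?_, hg⟩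
    intro p
    rw [hfg p]
    constructor
    · rintro ⟨x, rfl⟩
      exact ⟨e x, congrArg f (e.symm_apply_apply x)⟩
    · rintro ⟨x, rfl⟩
      exact ⟨e.symm x, rfl⟩

lemma Syz.succ_intro [IsNoetherianRing R] {n : ℕ} {M P N : Type u} [AddCommGroup M] [Module R M]
    [AddCommGroup P] [Module R P] [AddCommGroup N] [Module R N] [Module.Finite R P]
    [Module.Projective R P] (f : M →ₗ[R] P) (g : P →ₗ[R] N) (hf : Function.Injective f)
    (hfg : Function.Exact f g) (hg : Function.Surjective g) (hN : Syz R n (ModuleCat.of R N)) :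
    Syz R (n + 1) (ModuleCat.of R M) :=
  ⟨Module.Finite.of_injective f hf, ModuleCat.of R P, ModuleCat.of R N, f, g,
    inferInstanceAs (Module.Finite R P), inferInstanceAs (Module.Projective R P), hN, hf, hfg, hg⟩

lemma Syz.succ_elim {n : ℕ} {M : Type u} [AddCommGroup M] [Module R M]
    (h : Syz R (n + 1) (ModuleCat.of R M)) :
    ∃ (P N : Type u) (_ : AddCommGroup P) (_ : AddCommGroup N) (_ : Module R P) (_ : Module R N)
      (f : M →ₗ[R] P) (g : P →ₗ[R] N), Module.Finite R P ∧ Module.Projective R P ∧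
      Syz R n (ModuleCat.of R N) ∧ Function.Injective f ∧ Function.Exact f g ∧
      Function.Surjective g := by
  obtain ⟨hM, P, L, f, g, hP, hP', hL, hf, hfg, hg⟩ := h
  exact ⟨P, L, inferInstance, inferInstance, inferInstance, inferInstance, f, g, hP, hP', hL,
    hf, hfg, hg⟩

lemma Syz.finite {n : ℕ} {M : Type u} [AddCommGroup M] [Module R M]
    (h : Syz R n (ModuleCat.of R M)) : Module.Finite R M := by
  cases n with
  | zero => exact h
  | succ n => exact h.1

lemma Syz.of_succ {n : ℕ} {M : ModuleCat.{u} R} (h : Syz R (n + 1) M) : Syz R n M := by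
  induction n generalizing M with
  | zero => exact h.1
  | succ n ih =>
    obtain ⟨hM, P, L, f, g, hP, hP', hL, hf, hfg, hg⟩ := h
    exact ⟨hM, P, L, f, g, hP, hP', ih hL, hf, hfg, hg⟩

lemma Syz.of_le {n k : ℕ} (hnk : n ≤ k) {M : ModuleCat.{u} R} (h : Syz R k M) : Syz R n M := by
  induction hnk with
  | refl => exact h
  | step _ ih => exact ih h.of_succ

/-- A submodule of a finitely generated projective module is a first syzygy. -/
lemma Syz.one_of_injective [IsNoetherianRing R] {M P : Type u} [AddCommGroup M] [Module R M]
    [AddCommGroup P] [Module R P] [Module.Finite R P] [Module.Projective R P] (f : M →ₗ[R] P)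
    (hf : Function.Injective f) : Syz R 1 (ModuleCat.of R M) :=
  Syz.succ_intro f (LinearMap.range f).mkQ hf (LinearMap.exact_map_mkQ_range f)
    (Submodule.mkQ_surjective _) (inferInstanceAs (Module.Finite R (P ⧸ LinearMap.range f)))

lemma Syz.exists_injective {n : ℕ} {M : Type u} [AddCommGroup M] [Module R M]
    (h : Syz R (n + 1) (ModuleCat.of R M)) :
    ∃ (P : Type u) (_ : AddCommGroup P) (_ : Module R P) (f : M →ₗ[R] P), Module.Finite R P ∧
      Module.Projective R P ∧ Function.Injective f := by
  obtain ⟨P, N, _, _, _, _, f, g, hP, hP', -, hf, -, -⟩ := h.succ_elim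
  exact ⟨P, _, _, f, hP, hP', hf⟩

/-- The kernel of a map between finitely generated projective modules is a second syzygy. -/
lemma Syz.two_of_exact [IsNoetherianRing R] {M P Q : Type u} [AddCommGroup M] [Module R M]
    [AddCommGroup P] [Module R P] [AddCommGroup Q] [Module R Q] [Module.Finite R P]
    [Module.Projective R P] [Module.Finite R Q] [Module.Projective R Q]
    (f : M →ₗ[R] P) (h : P →ₗ[R] Q) (hf : Function.Injective f) (hfh : Function.Exact f h) :
    Syz R 2 (ModuleCat.of R M) := by
  refine Syz.succ_intro f h.rangeRestrict hf ?_ h.surjective_rangeRestrict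
    (Syz.one_of_injective (LinearMap.range h).subtype (Submodule.subtype_injective _))
  intro p
  rw [← hfh p, ← Subtype.coe_inj]
  rfl

/-- `A` is a direct summand of a module in `Syz R n`. -/
def IsSummandOfSyz (R : Type u) [CommRing R] (n : ℕ) (A : Type u) [AddCommGroup A]
    [Module R A] : Prop :=
  ∃ (L : Type u) (_ : AddCommGroup L) (_ : Module R L), Syz R n (ModuleCat.of R (A × L))

lemma IsSummandOfSyz.syz {n : ℕ} {A : Type u} [AddCommGroup A] [Module R A]
    (hA : IsSummandOfSyz R n A) (h : ClosedUnderDirectSummands R (Syz R n)) :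
    Syz R n (ModuleCat.of R A) := by
  obtain ⟨L, _, _, hL⟩ := hA
  exact h _ (ModuleCat.of R A) (ModuleCat.of R L) hL ⟨LinearEquiv.refl R (A × L)⟩

end SyzygyBasics

/-! ### Unimodular elements of projective modules. -/

section Unimodular

open IsLocalRing

variable {R : Type*} [CommRing R]

/-- The splitting of a module given by a functional `l` and an element `p` with `l p = 1`. -/
@[simps]
def equivKerProd {M : Type*} [AddCommGroup M] [Module R M] (l : M →ₗ[R] R) (p : M)
    (h : l p = 1) : M ≃ₗ[R] LinearMap.ker l × R where
  toFun x := (⟨x - l x • p, by simp [h]⟩, l x)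
  map_add' x y := by ext <;> simp [add_smul]; abel
  map_smul' r x := by ext <;> simp [smul_sub, smul_smul]
  invFun x := x.1 + x.2 • p
  left_inv x := by simp
  right_inv x := by
    have := x.1.2
    rw [LinearMap.mem_ker] at this
    ext <;> simp [this, h]

lemma projective_ker_of_apply_eq_one {M : Type*} [AddCommGroup M] [Module R M]
    [Module.Projective R M] (l : M →ₗ[R] R) (p : M) (h : l p = 1) :
    Module.Projective R (LinearMap.ker l) :=
  Module.Projective.of_split (LinearMap.ker l).subtype
    (LinearMap.fst R _ R ∘ₗ (equivKerProd l p h).toLinearMap) (by ext x; simp)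

lemma finite_ker_of_apply_eq_one {M : Type*} [AddCommGroup M] [Module R M]
    [Module.Finite R M] (l : M →ₗ[R] R) (p : M) (h : l p = 1) :
    Module.Finite R (LinearMap.ker l) :=
  Module.Finite.of_surjective (LinearMap.fst R _ R ∘ₗ (equivKerProd l p h).toLinearMap)
    (Prod.fst_surjective.comp (equivKerProd l p h).surjective)

/-- An element of a finitely generated projective module over a local ring that is not
unimodular lies in `𝔪 P`. -/
lemma mem_maximalIdeal_smul_top_or_exists_apply_eq_one [IsLocalRing R] {P : Type*}
    [AddCommGroup P] [Module R P] [Module.Finite R P] [Module.Projective R P] (v : P) :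
    v ∈ maximalIdeal R • (⊤ : Submodule R P) ∨ ∃ l : P →ₗ[R] R, l v = 1 := by
  have : Module.Free R P := Module.free_of_flat_of_isLocalRing
  let b := Module.Free.chooseBasis R P
  by_cases h : ∃ i, IsUnit (b.repr v i)
  · obtain ⟨i, u, hu⟩ := h
    right
    exact ⟨(↑u⁻¹ : R) • b.coord i, by simp [← hu]⟩
  · left
    push Not at h
    rw [← b.sum_repr v]
    exact Submodule.sum_mem _ fun i _ ↦
      Submodule.smul_mem_smul ((mem_maximalIdeal _).2 (h i)) trivial

lemma eq_zero_of_forall_apply_eq_zero {P : Type*} [AddCommGroup P] [Module R P]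
    [Module.Projective R P] {v : P} (h : ∀ l : P →ₗ[R] R, l v = 0) : v = 0 := by
  obtain ⟨s, hs⟩ := Module.projective_def'.1 (inferInstance : Module.Projective R P)
  have : s v = 0 := by
    ext i
    exact h (Finsupp.lapply i ∘ₗ s)
  rw [← LinearMap.id_apply (R := R) v, ← hs, LinearMap.comp_apply, this, map_zero]

end Unimodular

/-! ### Passing summands between `I` and `J`, and the depth-zero case. -/

section SyzygyStep

open TensorProduct in
lemma one_tmul_residueField_eq_zero_iff {R : Type*} [CommRing R] [IsLocalRing R] {M : Type*}
    [AddCommGroup M] [Module R M] (x : M) :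
    (1 : IsLocalRing.ResidueField R) ⊗ₜ[R] x = 0 ↔
      x ∈ IsLocalRing.maximalIdeal R • (⊤ : Submodule R M) := by
  rw [← Submodule.Quotient.mk_eq_zero, ← quotTensorEquivQuotSMul_mk_one_tmul]
  exact ((quotTensorEquivQuotSMul M (IsLocalRing.maximalIdeal R)).map_eq_zero_iff).symm


open IsLocalRing

variable {R : Type u} [CommRing R] [IsLocalRing R] {I J : Ideal R}

/-- Over a local ring with nonzero socle, a second syzygy with zero socle vanishes. -/
lemma Syz.eq_zero_of_socle {s : R} (hs : s ≠ 0) (hms : ∀ a ∈ maximalIdeal R, a * s = 0)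
    {M : Type u} [AddCommGroup M] [Module R M] (hM : Syz R 2 (ModuleCat.of R M))
    (hsoc : ∀ x : M, (∀ a ∈ maximalIdeal R, a • x = 0) → x = 0) (x : M) : x = 0 := by
  obtain ⟨P, N, _, _, _, _, f, g, _, _, hN, hf, hfg, -⟩ := hM.succ_elim
  obtain ⟨Q, _, _, h, _, _, hh⟩ := hN.exists_injective
  have hfree : Module.Free R Q := Module.free_of_flat_of_isLocalRing
  -- The composite `h ∘ g` is injective modulo `𝔪`: if `p` were unimodular with `h (g p) ∈ 𝔪 Q`,
  -- then `s • p` would come from a socle element of `M`, hence vanish. So `h ∘ g` is split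
  -- injective, although it kills the image of `M`.
  have key : ∀ p : P, h (g p) ∈ maximalIdeal R • (⊤ : Submodule R Q) →
      p ∈ maximalIdeal R • (⊤ : Submodule R P) := by
    intro p hp
    refine (mem_maximalIdeal_smul_top_or_exists_apply_eq_one p).resolve_right ?_
    rintro ⟨l, hl⟩
    have hkill : ∀ y ∈ maximalIdeal R • (⊤ : Submodule R Q), s • y = 0 := by
      intro y hy
      induction hy using Submodule.smul_induction_on' with
      | smul a ha z _ => rw [smul_smul, mul_comm, hms a ha, zero_smul]
      | add y _ z _ hy hz => rw [smul_add, hy, hz, add_zero]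
    have h0 : g (s • p) = 0 := hh (by rw [map_smul, map_smul, hkill _ hp, map_zero])
    obtain ⟨y, hy⟩ := (hfg _).1 h0
    have hy0 : y = 0 := by
      refine hsoc y fun a ha ↦ hf ?_
      rw [map_smul, hy, smul_smul, hms a ha, zero_smul, map_zero]
    rw [hy0, map_zero] at hy
    refine hs ?_
    have := congrArg l hy
    rw [map_zero, map_smul, hl, smul_eq_mul, mul_one] at this
    exact this.symm
  obtain ⟨k, hk⟩ := (split_injective_iff_lTensor_residueField_injective (h ∘ₗ g)).2 (by
    rw [← LinearMap.ker_eq_bot, LinearMap.ker_eq_bot']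
    intro t ht
    obtain ⟨p, rfl⟩ := TensorProduct.mk_surjective R P (ResidueField R)
      (residue_surjective (R := R)) t
    rw [TensorProduct.mk_apply, LinearMap.lTensor_tmul, one_tmul_residueField_eq_zero_iff] at ht
    exact (one_tmul_residueField_eq_zero_iff p).2 (key p ht))
  have hinj : Function.Injective (h ∘ₗ g) :=
    Function.LeftInverse.injective (g := k) (LinearMap.congr_fun hk)
  refine hf (hinj ?_)
  rw [map_zero, LinearMap.comp_apply, (hfg _).2 ⟨x, rfl⟩, map_zero, map_zero]

variable [IsNoetherianRing R]

/-- If `J` is a summand of an `n`-th syzygy then `I` is a summand of an `(n+1)`-st syzygy. -/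
lemma IsSummandOfSyz.succ_of_maximalIdeal_eq_sup (hJ : J ≠ ⊥) (hsum : I ⊔ J = maximalIdeal R)
    (hinf : I ⊓ J = ⊥) {n : ℕ} (h : IsSummandOfSyz R n J) : IsSummandOfSyz R (n + 1) I := by
  obtain ⟨L, _, _, hL⟩ := h
  have hfin : Module.Finite R L := by
    have := hL.finite
    exact Module.Finite.of_surjective (LinearMap.snd R J L) Prod.snd_surjective
  have hnt : Nontrivial J := (Submodule.nontrivial_iff_ne_bot).2 hJ
  -- The cover of `J` uses `x` together with generators of a maximal submodule `N` not containing
  -- `x`; a relation with a unit coefficient at `x` would put `x` in `N`.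
  obtain ⟨N, hN, -⟩ := (eq_top_or_exists_le_coatom (⊥ : Submodule R J)).resolve_left bot_ne_top
  obtain ⟨x, -, hx⟩ := SetLike.exists_of_lt hN.lt_top
  obtain ⟨a, q, hq⟩ := Module.Finite.exists_fin' R N
  obtain ⟨b, q', hq'⟩ := Module.Finite.exists_fin' R L
  let G₁ : R × (Fin a → R) →ₗ[R] J :=
    LinearMap.coprod (LinearMap.toSpanSingleton R J x) (N.subtype ∘ₗ q)
  let G : (R × (Fin a → R)) × (Fin b → R) →ₗ[R] J × L := LinearMap.prodMap G₁ q'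
  have hG₁ : Function.Surjective G₁ := by
    have htop : Submodule.span R {x} ⊔ N = ⊤ := hN.2 _ (by
      refine lt_of_le_of_ne le_sup_right fun h ↦ hx ?_
      rw [h]
      exact Submodule.mem_sup_left (Submodule.mem_span_singleton_self x))
    intro y
    obtain ⟨z, hz, w, hw, rfl⟩ := Submodule.mem_sup.1 (htop ▸ Submodule.mem_top (x := y))
    obtain ⟨r, rfl⟩ := Submodule.mem_span_singleton.1 hz
    obtain ⟨c, hc⟩ := hq ⟨w, hw⟩
    exact ⟨(r, c), by simp [G₁, hc]⟩
  have hG : Function.Surjective G := by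
    rintro ⟨y, l⟩
    obtain ⟨c, rfl⟩ := hG₁ y
    obtain ⟨d, rfl⟩ := hq' l
    exact ⟨(c, d), rfl⟩
  -- Relations with first coordinate in `J`. Since `I` kills `x`, the kernel of `G` is the direct
  -- sum of `K` and the copy of `I` in the first coordinate.
  let K : Submodule R ((R × (Fin a → R)) × (Fin b → R)) :=
    LinearMap.ker G ⊓ Submodule.comap (LinearMap.fst R _ _ ∘ₗ LinearMap.fst R _ _) J
  let F : I × K →ₗ[R] (R × (Fin a → R)) × (Fin b → R) :=
    LinearMap.coprod (LinearMap.inl R _ _ ∘ₗ LinearMap.inl R _ _ ∘ₗ I.subtype) K.subtype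
  have hGI : ∀ i ∈ I, G ((i, 0), 0) = 0 := by
    intro i hi
    have : i • x = 0 := Subtype.ext (Ideal.mul_eq_zero_of_inf_eq_bot hinf hi x.2)
    simp [G, G₁, this]
  refine ⟨K, _, _, Syz.succ_intro F G ?_ ?_ hG hL⟩
  · rw [← LinearMap.ker_eq_bot, LinearMap.ker_eq_bot']
    rintro ⟨⟨i, hi⟩, ⟨⟨⟨r, c⟩, d⟩, hk⟩⟩ h
    have hr : r ∈ J := hk.2
    simp only [F, LinearMap.coprod_apply, LinearMap.comp_apply, Submodule.subtype_apply,
      LinearMap.inl_apply, Prod.mk_add_mk, zero_add, Prod.mk_eq_zero] at h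
    obtain ⟨⟨h1, rfl⟩, rfl⟩ := h
    have hi0 : i = 0 := Ideal.eq_zero_of_mem_of_inf_eq_bot hinf hi (by
      rw [eq_neg_of_add_eq_zero_left h1]; exact J.neg_mem hr)
    subst hi0
    rw [zero_add] at h1
    subst h1
    rfl
  · rintro ⟨⟨r, c⟩, d⟩
    constructor
    · intro h
      have hr : r ∈ maximalIdeal R := by
        rw [mem_maximalIdeal]
        rintro ⟨u, rfl⟩
        have h1 : (u : R) • x + (q c : J) = 0 := congrArg Prod.fst h
        refine hx ?_
        rw [← Submodule.smul_mem_iff_of_isUnit N u.isUnit, eq_neg_of_add_eq_zero_left h1]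
        exact N.neg_mem (q c).2
      rw [← hsum] at hr
      obtain ⟨i, hi, j, hj, rfl⟩ := Submodule.mem_sup.1 hr
      refine ⟨(⟨i, hi⟩, ⟨((j, c), d), ?_, hj⟩), by simp [F]⟩
      rw [SetLike.mem_coe, LinearMap.mem_ker]
      have : (((j, c), d) : (R × (Fin a → R)) × (Fin b → R)) =
        ((i + j, c), d) - ((i, 0), 0) := by simp
      rw [this, map_sub, h, hGI i hi, sub_zero]
    · rintro ⟨⟨i, k⟩, hk⟩
      rw [← hk]
      simp only [F, LinearMap.coprod_apply, map_add, LinearMap.comp_apply,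
        Submodule.subtype_apply, LinearMap.inl_apply]
      rw [hGI _ i.2, zero_add]
      exact k.2.1

/-- Each syzygy step exchanges `I` and `J`, so the induction carries both. -/
lemma IsSummandOfSyz.of_two_le (hI : I ≠ ⊥) (hJ : J ≠ ⊥) (hsum : I ⊔ J = maximalIdeal R)
    (hinf : I ⊓ J = ⊥) (hI2 : IsSummandOfSyz R 2 I) (hJ2 : IsSummandOfSyz R 2 J) {n : ℕ}
    (hn : 2 ≤ n) : IsSummandOfSyz R n I ∧ IsSummandOfSyz R n J := by
  induction hn with
  | refl => exact ⟨hI2, hJ2⟩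
  | step _ ih =>
    exact ⟨ih.2.succ_of_maximalIdeal_eq_sup hJ hsum hinf,
      ih.1.succ_of_maximalIdeal_eq_sup hI (sup_comm I J ▸ hsum) (inf_comm I J ▸ hinf)⟩

lemma moduleDepth_eq_zero_and_not_closed (hI : I ≠ ⊥) (hJ : J ≠ ⊥)
    (hsum : I ⊔ J = maximalIdeal R) (hinf : I ⊓ J = ⊥) (hdI : moduleDepth R (R ⧸ I) = 0)
    (hdJ : 1 ≤ moduleDepth R (R ⧸ J)) :
    moduleDepth R R = 0 ∧ ∀ n : ℕ, 2 ≤ n → ¬ ClosedUnderDirectSummands R (Syz R n) := by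
  have hJsat := Ideal.isMaxSaturated_of_one_le_moduleDepth hdJ
  have hIle : I ≤ maximalIdeal R := hsum ▸ le_sup_left
  have hJle : J ≤ maximalIdeal R := hsum ▸ le_sup_right
  have hImax : I ≠ maximalIdeal R := by
    rintro rfl
    exact hJ (by rwa [inf_eq_right.2 hJle] at hinf)
  have hnt : Nontrivial (R ⧸ I) := Ideal.Quotient.nontrivial_iff.2
    (ne_top_of_le_ne_top (maximalIdeal.isMaximal R).ne_top hIle)
  obtain ⟨x, hx, hmx⟩ := exists_socle_of_moduleDepth_eq_zero hdI
  obtain ⟨r, rfl⟩ := Ideal.Quotient.mk_surjective x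
  have hxI : r ∉ I := fun h ↦ hx (Ideal.Quotient.eq_zero_iff_mem.2 h)
  have hmr : ∀ a ∈ maximalIdeal R, a * r ∈ I := by
    intro a ha
    rw [← Ideal.Quotient.eq_zero_iff_mem, map_mul]
    exact hmx a ha
  have hrm : r ∈ maximalIdeal R := by
    rw [mem_maximalIdeal]
    intro hu
    exact hImax (le_antisymm hIle fun a ha ↦ (I.mul_unit_mem_iff_mem hu).1 (hmr a ha))
  rw [← hsum] at hrm
  obtain ⟨i, hi, s, hs, rfl⟩ := Submodule.mem_sup.1 hrm
  have hs0 : s ≠ 0 := by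
    rintro rfl
    exact hxI (by simpa using hi)
  -- `a * s` is in `J`, and also in `I` because `a * (i + s)` is.
  have hms : ∀ a ∈ maximalIdeal R, a * s = 0 := fun a ha ↦
    Ideal.eq_zero_of_mem_of_inf_eq_bot hinf (by
      rw [show a * s = a * (i + s) - a * i by ring]
      exact I.sub_mem (hmr a ha) (I.mul_mem_left _ hi)) (J.mul_mem_left _ hs)
  refine ⟨moduleDepth_eq_zero_of_socle hs0 hms, fun n hn hclosed ↦ ?_⟩
  have hsyz : Syz R 2 (ModuleCat.of R (I × J)) := by
    refine Syz.two_of_exact (LinearMap.coprod I.subtype J.subtype) (LinearMap.mulRight R s) ?_ ?_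
    · rw [← LinearMap.ker_eq_bot, LinearMap.ker_eq_bot']
      rintro ⟨⟨a, ha⟩, ⟨b, hb⟩⟩ h
      have hab : a + b = 0 := h
      have ha0 : a = 0 := Ideal.eq_zero_of_mem_of_inf_eq_bot hinf ha (by
        rw [eq_neg_of_add_eq_zero_left hab]; exact J.neg_mem hb)
      subst ha0
      rw [zero_add] at hab
      subst hab
      rfl
    · intro y
      rw [LinearMap.mulRight_apply]
      constructor
      · intro h
        have hy : y ∈ maximalIdeal R := by
          rw [mem_maximalIdeal]
          intro hu
          exact hs0 (hu.mul_right_eq_zero.1 h)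
        rw [← hsum] at hy
        obtain ⟨a, ha, b, hb, rfl⟩ := Submodule.mem_sup.1 hy
        exact ⟨(⟨a, ha⟩, ⟨b, hb⟩), rfl⟩
      · rintro ⟨⟨⟨a, ha⟩, ⟨b, hb⟩⟩, rfl⟩
        exact hms _ (add_mem (hIle ha) (hJle hb))
  have hIn := (IsSummandOfSyz.of_two_le hI hJ hsum hinf ⟨J, _, _, hsyz⟩
    ⟨I, _, _, hsyz.of_equiv (LinearEquiv.prodComm R I J)⟩ hn).1.syz hclosed
  refine hI ((Submodule.eq_bot_iff I).2 fun a ha ↦ ?_)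
  refine congrArg Subtype.val ((hIn.of_le hn).eq_zero_of_socle hs0 hms (fun y hy ↦ ?_) ⟨a, ha⟩)
  -- A socle element of `I` lies in `J` by saturation of `J`, hence is zero.
  refine Subtype.ext (Ideal.eq_zero_of_mem_of_inf_eq_bot hinf y.2 (hJsat _ fun b hb ↦ ?_))
  have : b * (y : R) = 0 := congrArg Subtype.val (hy b hb)
  rw [this]
  exact J.zero_mem

end SyzygyStep

/-! ### Splittings where both quotients have zero socle: annihilators and cancellation. -/

open IsLocalRing in
/-- A decomposition `𝔪 = I ⊕ J` of the maximal ideal such that neither `R ⧸ I` nor `R ⧸ J` has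
a nonzero socle. -/
structure IsSaturatedSplitting {R : Type*} [CommRing R] [IsLocalRing R] (I J : Ideal R) :
    Prop where
  sup_eq : I ⊔ J = maximalIdeal R
  inf_eq : I ⊓ J = ⊥
  left_sat : I.IsMaxSaturated
  right_sat : J.IsMaxSaturated
  left_ne : I ≠ ⊥
  right_ne : J ≠ ⊥

namespace IsSaturatedSplitting

open IsLocalRing

variable {R : Type u} [CommRing R] [IsLocalRing R] {I J : Ideal R}

lemma symm (h : IsSaturatedSplitting I J) : IsSaturatedSplitting J I :=
  ⟨sup_comm I J ▸ h.sup_eq, inf_comm I J ▸ h.inf_eq, h.right_sat, h.left_sat, h.right_ne,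
    h.left_ne⟩

variable (h : IsSaturatedSplitting I J)
include h

lemma left_le : I ≤ maximalIdeal R := h.sup_eq ▸ le_sup_left

lemma right_le : J ≤ maximalIdeal R := h.sup_eq ▸ le_sup_right

lemma exists_add {a : R} (ha : a ∈ maximalIdeal R) : ∃ i ∈ I, ∃ j ∈ J, i + j = a := by
  rw [← h.sup_eq] at ha
  exact Submodule.mem_sup.1 ha

lemma mul_eq_zero {i j : R} (hi : i ∈ I) (hj : j ∈ J) : i * j = 0 :=
  Ideal.mul_eq_zero_of_inf_eq_bot h.inf_eq hi hj

/-- If `J` kills `r`, then `𝔪 r = I r ⊆ I`, and saturation applies. With `mul_eq_zero`, `I` is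
exactly the annihilator of `J`. -/
lemma mem_left_of_annihilate {r : R} (hr : ∀ j ∈ J, j * r = 0) : r ∈ I := by
  refine h.left_sat r fun a ha ↦ ?_
  obtain ⟨i, hi, j, hj, rfl⟩ := h.exists_add ha
  rw [add_mul, hr j hj, add_zero]
  exact I.mul_mem_right _ hi

lemma mem_right_of_annihilate {r : R} (hr : ∀ i ∈ I, i * r = 0) : r ∈ J :=
  h.symm.mem_left_of_annihilate hr

lemma eq_zero_of_annihilate {r : R} (hI : ∀ i ∈ I, i * r = 0) (hJ : ∀ j ∈ J, j * r = 0) :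
    r = 0 :=
  Ideal.eq_zero_of_mem_of_inf_eq_bot h.inf_eq (h.mem_left_of_annihilate hJ)
    (h.mem_right_of_annihilate hI)

lemma proj_eq_zero_of_annihilate {P : Type*} [AddCommGroup P] [Module R P]
    [Module.Projective R P] {v : P} (hI : ∀ i ∈ I, i • v = 0) (hJ : ∀ j ∈ J, j • v = 0) :
    v = 0 := by
  refine eq_zero_of_forall_apply_eq_zero fun l ↦ h.eq_zero_of_annihilate (fun i hi ↦ ?_)
    fun j hj ↦ ?_
  · rw [← smul_eq_mul, ← map_smul, hI i hi, map_zero]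
  · rw [← smul_eq_mul, ← map_smul, hJ j hj, map_zero]

lemma syz_eq_zero_of_annihilate {n : ℕ} {M : Type u} [AddCommGroup M] [Module R M]
    (hM : Syz R (n + 1) (ModuleCat.of R M)) {v : M} (hI : ∀ i ∈ I, i • v = 0)
    (hJ : ∀ j ∈ J, j • v = 0) : v = 0 := by
  obtain ⟨P, _, _, f, _, _, hf⟩ := hM.exists_injective
  refine hf ?_
  rw [map_zero]
  refine h.proj_eq_zero_of_annihilate (fun i hi ↦ ?_) fun j hj ↦ ?_
  · rw [← map_smul, hI i hi, map_zero]
  · rw [← map_smul, hJ j hj, map_zero]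

lemma smul_eq_zero_of_mem {M : Type*} [AddCommGroup M] [Module R M] {v : M}
    (hv : v ∈ I • (⊤ : Submodule R M)) {j : R} (hj : j ∈ J) : j • v = 0 := by
  induction hv using Submodule.smul_induction_on' with
  | smul a ha z _ => rw [smul_smul, mul_comm, h.mul_eq_zero ha hj, zero_smul]
  | add y _ z _ hy hz => rw [smul_add, hy, hz, add_zero]

/-- An element of a finitely generated projective module is unimodular or decomposes along
`I` and `J`. -/
lemma exists_decomposition {P : Type*} [AddCommGroup P] [Module R P] [Module.Finite R P]
    [Module.Projective R P] (v : P) :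
    (∃ v₁ v₂ : P, v₁ + v₂ = v ∧ (∀ j ∈ J, j • v₁ = 0) ∧ ∀ i ∈ I, i • v₂ = 0) ∨
      ∃ l : P →ₗ[R] R, l v = 1 := by
  refine (mem_maximalIdeal_smul_top_or_exists_apply_eq_one v).imp_left fun hv ↦ ?_
  rw [← h.sup_eq, Submodule.sup_smul] at hv
  obtain ⟨v₁, hv₁, v₂, hv₂, rfl⟩ := Submodule.mem_sup.1 hv
  exact ⟨v₁, v₂, rfl, fun j hj ↦ h.smul_eq_zero_of_mem hv₁ hj,
    fun i hi ↦ h.symm.smul_eq_zero_of_mem hv₂ hi⟩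

/-- A unimodular element has zero annihilator, but `J ≠ ⊥`. -/
lemma mem_smul_top_of_annihilate {P : Type*} [AddCommGroup P] [Module R P] [Module.Finite R P]
    [Module.Projective R P] {v : P} (hv : ∀ j ∈ J, j • v = 0) :
    v ∈ maximalIdeal R • (⊤ : Submodule R P) := by
  refine (mem_maximalIdeal_smul_top_or_exists_apply_eq_one v).resolve_right ?_
  rintro ⟨l, hl⟩
  refine h.right_ne ((Submodule.eq_bot_iff J).2 fun j hj ↦ ?_)
  have := congrArg l (hv j hj)
  rwa [map_smul, hl, map_zero, smul_eq_mul, mul_one] at this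

section Noetherian

variable [IsNoetherianRing R]

/-- As the annihilator of `J`, the ideal `I` is the kernel of the map `R → Rᵃ` given by generators
of `J`. -/
lemma syz_two_left : Syz R 2 (ModuleCat.of R I) := by
  obtain ⟨a, q, hq⟩ := Module.Finite.exists_fin' R J
  refine Syz.two_of_exact I.subtype
    (LinearMap.pi fun i : Fin a ↦ LinearMap.mulRight R (q (Pi.single i 1) : R))
    (Submodule.subtype_injective _) fun r ↦ ?_
  constructor
  · intro hr
    refine ⟨⟨r, h.mem_left_of_annihilate fun j hj ↦ ?_⟩, rfl⟩
    obtain ⟨c, hc⟩ := hq ⟨j, hj⟩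
    have hj' : j = ∑ i, c i * (q (Pi.single i 1) : R) := by
      have h1 := congrArg Subtype.val hc
      rw [pi_eq_sum_univ' c, map_sum] at h1
      simp only [map_smul] at h1
      rw [← h1]
      simp
    rw [hj', Finset.sum_mul]
    refine Finset.sum_eq_zero fun i _ ↦ ?_
    have := congrFun hr i
    simp only [LinearMap.pi_apply, LinearMap.mulRight_apply, Pi.zero_apply] at this
    rw [mul_assoc, mul_comm _ r, this, mul_zero]
  · rintro ⟨⟨r, hr⟩, rfl⟩
    ext i
    exact h.mul_eq_zero hr (q _).2

/-- A free summand may be cancelled from a syzygy. -/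
lemma syz_of_prod_ring {n : ℕ} {M : Type u} [AddCommGroup M] [Module R M]
    (hM : Syz R (n + 1) (ModuleCat.of R (M × R))) : Syz R (n + 1) (ModuleCat.of R M) := by
  obtain ⟨P, N, _, _, _, _, f, g, _, _, hN, hf, hfg, hg⟩ := hM.succ_elim
  cases n with
  | zero => exact Syz.one_of_injective (f ∘ₗ LinearMap.inl R M R) (hf.comp LinearMap.inl_injective)
  | succ n =>
  have hgf : ∀ x, g (f x) = 0 := fun x ↦ (hfg _).2 ⟨x, rfl⟩
  -- If `f (0, 1)` is not unimodular, `g v₁ = -g v₂` is killed by both `I` and `J`, so it vanishes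
  -- in the syzygy `N`. Then `v₁` and `v₂` come from `M × R`, and their last coordinates, in `I` and
  -- `J`, would sum to `1`.
  rcases h.exists_decomposition (f (0, 1)) with ⟨v₁, v₂, hv, hv₁, hv₂⟩ | ⟨l, hl⟩
  · exfalso
    have hg12 : g v₁ + g v₂ = 0 := by rw [← map_add, hv, hgf]
    have hg1 : g v₁ = 0 := by
      refine h.syz_eq_zero_of_annihilate hN (fun i hi ↦ ?_) fun j hj ↦ ?_
      · rw [eq_neg_of_add_eq_zero_left hg12, smul_neg, ← map_smul, hv₂ i hi, map_zero, neg_zero]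
      · rw [← map_smul, hv₁ j hj, map_zero]
    have hg2 : g v₂ = 0 := by rwa [hg1, zero_add] at hg12
    obtain ⟨⟨x₁, r₁⟩, rfl⟩ := (hfg _).1 hg1
    obtain ⟨⟨x₂, r₂⟩, rfl⟩ := (hfg _).1 hg2
    rw [← map_add] at hv
    have h1 : r₁ + r₂ = 1 := congrArg Prod.snd (hf hv)
    have hr₁ : r₁ ∈ I := h.mem_left_of_annihilate fun j hj ↦ by
      have := hv₁ j hj
      rw [← map_smul, map_eq_zero_iff f hf] at this
      exact congrArg Prod.snd this
    have hr₂ : r₂ ∈ J := h.mem_right_of_annihilate fun i hi ↦ by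
      have := hv₂ i hi
      rw [← map_smul, map_eq_zero_iff f hf] at this
      exact congrArg Prod.snd this
    refine (maximalIdeal.isMaximal R).ne_top ((Ideal.eq_top_iff_one _).2 ?_)
    rw [← h1]
    exact add_mem (h.left_le hr₁) (h.right_le hr₂)
  · have := projective_ker_of_apply_eq_one l _ hl
    have hfx : ∀ (x : M) (r : R), f (x, r) = f (x, 0) + r • f (0, 1) := by
      intro x r
      rw [← map_smul, ← map_add]
      simp
    -- In the unimodular case, project `M` to `ker l` along `f (0, 1)`; the cokernel is still `N`.
    let f' : M →ₗ[R] LinearMap.ker l :=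
      LinearMap.fst R _ R ∘ₗ (equivKerProd l _ hl).toLinearMap ∘ₗ f ∘ₗ LinearMap.inl R M R
    have hf'x : ∀ x, (f' x : P) = f (x, -l (f (x, 0))) := by
      intro x
      rw [hfx]
      simp [f', sub_eq_add_neg]
    refine Syz.succ_intro f' (g ∘ₗ (LinearMap.ker l).subtype) ?_ ?_ ?_ hN
    · intro x y hxy
      have := congrArg Subtype.val hxy
      rw [hf'x, hf'x] at this
      exact congrArg Prod.fst (hf this)
    · rintro ⟨p, hp⟩
      constructor
      · intro h0
        obtain ⟨⟨x, r⟩, rfl⟩ := (hfg _).1 h0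
        refine ⟨x, Subtype.ext ?_⟩
        rw [hf'x]
        rw [LinearMap.mem_ker, hfx, map_add, map_smul, hl, smul_eq_mul, mul_one] at hp
        rw [neg_eq_of_add_eq_zero_right hp]
      · rintro ⟨x, hx⟩
        rw [← hx, LinearMap.comp_apply, Submodule.subtype_apply, hf'x, hgf]
    · intro y
      obtain ⟨p, rfl⟩ := hg y
      refine ⟨(equivKerProd l _ hl p).1, ?_⟩
      simp [hgf]

lemma syz_of_prod_free {n : ℕ} {M F : Type u} [AddCommGroup M] [Module R M]
    [AddCommGroup F] [Module R F] [Module.Finite R F] [Module.Projective R F]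
    (hM : Syz R (n + 1) (ModuleCat.of R (M × F))) : Syz R (n + 1) (ModuleCat.of R M) := by
  have : Module.Free R F := Module.free_of_flat_of_isLocalRing
  have key : ∀ c : ℕ, Syz R (n + 1) (ModuleCat.of R (M × (Fin c → R))) →
      Syz R (n + 1) (ModuleCat.of R M) := by
    intro c
    induction c with
    | zero =>
      intro hc
      exact hc.of_equiv LinearEquiv.prodUnique
    | succ c ih =>
      intro hc
      refine ih (h.syz_of_prod_ring (hc.of_equiv ?_))
      exact ((LinearEquiv.refl R M).prodCongr ((Fin.consLinearEquiv R fun _ ↦ R).symm ≪≫ₗ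
        LinearEquiv.prodComm R R (Fin c → R))) ≪≫ₗ (LinearEquiv.prodAssoc R M (Fin c → R) R).symm
  exact key _ (hM.of_equiv ((LinearEquiv.refl R M).prodCongr (Module.finBasis R F).equivFun))

end Noetherian

end IsSaturatedSplitting

/-! ### From syzygies to principal ideals. -/

namespace IsSaturatedSplitting

open IsLocalRing

variable {R : Type u} [CommRing R] [IsLocalRing R] [IsNoetherianRing R] {I J : Ideal R}
  (h : IsSaturatedSplitting I J)
include h

/-- If every linear map `J → R` is a homothety and `J` is an `(n+1)`-st syzygy, then `R ⧸ J` is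
an `n`-th syzygy. -/
lemma syz_quotient_of_syz (hhom : ∀ φ : J →ₗ[R] R, ∃ s, ∀ y : J, φ y = y * s) {n : ℕ}
    (hJ : Syz R (n + 2) (ModuleCat.of R J)) : Syz R (n + 1) (ModuleCat.of R (R ⧸ J)) := by
  obtain ⟨P, N, _, _, _, _, f, g, _, _, hN, hf, hfg, hg⟩ := hJ.succ_elim
  have hgf : ∀ x, g (f x) = 0 := fun x ↦ (hfg _).2 ⟨x, rfl⟩
  have : Module.Free R P := Module.free_of_flat_of_isLocalRing
  obtain ⟨v, hv⟩ : ∃ v : P, ∀ y : J, f y = (y : R) • v := by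
    let b := Module.finBasis R P
    choose s hs using fun i ↦ hhom (b.coord i ∘ₗ f)
    refine ⟨∑ i, s i • b i, fun y ↦ ?_⟩
    rw [← b.sum_repr (f y), Finset.smul_sum]
    refine Finset.sum_congr rfl fun i _ ↦ ?_
    rw [smul_smul, ← hs i y]
    rfl
  -- If `v` is not unimodular, only `v₂` matters, since `J` kills `v₁`. Then `g v₂ = 0`, so `v₂ = y
  -- • v₂` with `y ∈ J ⊆ 𝔪`, giving `v₂ = 0` and `J = 0`. If `v` is unimodular, `N ≅ R ⧸ J × ker l`
  -- and the free factor cancels.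
  rcases h.exists_decomposition v with ⟨v₁, v₂, rfl, hv₁, hv₂⟩ | ⟨l, hl⟩
  · exfalso
    have hfy : ∀ y : J, f y = (y : R) • v₂ := fun y ↦ by
      rw [hv y, smul_add, hv₁ y y.2, zero_add]
    have hg2 : g v₂ = 0 := by
      refine h.syz_eq_zero_of_annihilate hN (fun i hi ↦ ?_) fun j hj ↦ ?_
      · rw [← map_smul, hv₂ i hi, map_zero]
      · rw [← map_smul, ← hfy ⟨j, hj⟩, hgf]
    obtain ⟨y, hy⟩ := (hfg _).1 hg2
    have hy1 : (1 - (y : R)) • v₂ = 0 := by rw [sub_smul, one_smul, ← hfy, hy, sub_self]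
    have hu : IsUnit (1 - (y : R)) :=
      (isUnit_or_isUnit_one_sub_self (y : R)).resolve_left
        ((mem_maximalIdeal _).1 (h.right_le y.2))
    have hv0 : v₂ = 0 := (hu.smul_eq_zero).1 hy1
    refine h.right_ne ((Submodule.eq_bot_iff J).2 fun j hj ↦ ?_)
    refine congrArg Subtype.val (hf (a₁ := ⟨j, hj⟩) (a₂ := 0) ?_)
    rw [hfy, hv0, smul_zero, map_zero]
  · have := projective_ker_of_apply_eq_one l v hl
    have := finite_ker_of_apply_eq_one l v hl
    refine h.syz_of_prod_free (F := LinearMap.ker l) (hN.of_equiv (LinearEquiv.symm ?_))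
    let ψ : (R ⧸ J) × LinearMap.ker l →ₗ[R] N :=
      LinearMap.coprod (Submodule.liftQ J (LinearMap.toSpanSingleton R N (g v)) (fun j hj ↦ by
        rw [LinearMap.mem_ker, LinearMap.toSpanSingleton_apply, ← map_smul, ← hv ⟨j, hj⟩, hgf]))
        (g ∘ₗ (LinearMap.ker l).subtype)
    have hψ : ∀ (r : R) (q : LinearMap.ker l), ψ (Submodule.Quotient.mk r, q) =
        g (r • v + q) := by
      intro r q
      rw [map_add, map_smul]
      rfl
    refine LinearEquiv.ofBijective ψ ⟨?_, ?_⟩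
    · rw [← LinearMap.ker_eq_bot, LinearMap.ker_eq_bot']
      rintro ⟨x, ⟨q, hq⟩⟩ hx
      obtain ⟨r, rfl⟩ := Submodule.Quotient.mk_surjective J x
      rw [hψ] at hx
      obtain ⟨y, hy⟩ := (hfg _).1 hx
      rw [hv] at hy
      have hyr : (y : R) = r := by
        have := congrArg l hy
        rw [LinearMap.mem_ker] at hq
        simpa [hl, hq] using this
      rw [hyr, left_eq_add] at hy
      have h1 : (Submodule.Quotient.mk r : R ⧸ J) = 0 :=
        (Submodule.Quotient.mk_eq_zero J).2 (hyr ▸ y.2)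
      rw [h1]
      exact Prod.ext rfl (Subtype.ext hy)
    · intro x
      obtain ⟨p, rfl⟩ := hg x
      refine ⟨(Submodule.Quotient.mk (l p), (equivKerProd l v hl p).1), ?_⟩
      rw [hψ]
      simp

/-- Let `w` be an element with annihilator `J` of a finitely generated free module `P`. If `P ⧸ R w`
is an `n`-th syzygy with `n ≥ 2`, then `I` is principal and `R ⧸ I` is an `n`-th syzygy. -/
lemma exists_generator_of_syz_cyclic_quotient {n : ℕ} (c : ℕ) :
    ∀ (P L : Type u) [AddCommGroup P] [Module R P] [AddCommGroup L] [Module R L]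
      [Module.Finite R P] [Module.Projective R P] (π : P →ₗ[R] L) (w : P),
      Module.finrank R P = c → Function.Surjective π → (∀ p, π p = 0 ↔ ∃ r : R, r • w = p) →
      (∀ r : R, r • w = 0 ↔ r ∈ J) → Syz R (n + 2) (ModuleCat.of R L) →
      ∃ z : R, I = Ideal.span {z} ∧ (∀ r, r * z = 0 ↔ r ∈ J) ∧
        Syz R (n + 2) (ModuleCat.of R (R ⧸ I)) := by
  induction c with
  | zero =>
    intro P L _ _ _ _ _ _ π w hrank _ _ hann _
    exfalso
    have : Module.Free R P := Module.free_of_flat_of_isLocalRing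
    have : Subsingleton P := (Module.finrank_eq_zero_iff_of_free R P).1 hrank
    have h1 : (1 : R) ∈ J := (hann 1).1 (Subsingleton.elim _ _)
    exact (maximalIdeal.isMaximal R).ne_top ((Ideal.eq_top_iff_one _).2 (h.right_le h1))
  | succ c ih =>
    intro P L _ _ _ _ _ _ π w hrank hπ hker hann hL
    have : Module.Free R P := Module.free_of_flat_of_isLocalRing
    have hπw : π w = 0 := (hker w).2 ⟨1, one_smul R w⟩
    -- A free summand of `L` lifts to one of `P` and is removed from both, lowering the rank.
    by_cases hsplit : ∃ (l : L →ₗ[R] R) (x : L), l x = 1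
    · obtain ⟨l, x, hlx⟩ := hsplit
      obtain ⟨p, rfl⟩ := hπ x
      have hlp : (l ∘ₗ π) p = 1 := hlx
      have := projective_ker_of_apply_eq_one (l ∘ₗ π) p hlp
      have := finite_ker_of_apply_eq_one (l ∘ₗ π) p hlp
      have : Module.Free R (LinearMap.ker (l ∘ₗ π)) := Module.free_of_flat_of_isLocalRing
      have hw : w ∈ LinearMap.ker (l ∘ₗ π) := by simp [hπw]
      refine ih (LinearMap.ker (l ∘ₗ π)) (LinearMap.ker l)
        (π.restrict (p := LinearMap.ker (l ∘ₗ π)) (q := LinearMap.ker l) (fun q hq ↦ hq))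
        ⟨w, hw⟩ ?_ ?_ ?_ ?_ (h.syz_of_prod_ring (hL.of_equiv (equivKerProd l _ hlx)))
      · have := (equivKerProd (l ∘ₗ π) p hlp).finrank_eq
        rw [hrank, Module.finrank_prod, Module.finrank_self] at this
        omega
      · rintro ⟨y, hy⟩
        obtain ⟨q, rfl⟩ := hπ y
        exact ⟨⟨q, hy⟩, rfl⟩
      · rintro ⟨q, hq⟩
        rw [← Subtype.coe_inj]
        refine (hker q).trans (exists_congr fun r ↦ ?_)
        rw [← Subtype.coe_inj]
        rfl
      · intro r
        rw [← hann r, ← Subtype.coe_inj]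
        rfl
    · obtain ⟨G, N, _, _, _, _, f, g, _, _, hN, hf, hfg, -⟩ := hL.succ_elim
      have hgf : ∀ x, g (f x) = 0 := fun x ↦ (hfg _).2 ⟨x, rfl⟩
      -- Without free summands in `L`, `I P ⊆ R w`: by Nakayama it suffices that `P = P₂ + 𝔪 P`.
      -- Splitting `f (π p)` along `I` and `J` lifts to `p = (p - p₁) + p₁` with `p - p₁ ∈ P₂` and
      -- `p₁` killed by `J`, hence in `𝔪 P`.
      have hIP : ∀ (i : R) (_ : i ∈ I) (p : P), ∃ r : R, r • w = i • p := by
        let P₂ : Submodule R P :=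
          { carrier := {p | ∀ i ∈ I, π (i • p) = 0}
            add_mem' := fun {a b} ha hb i hi ↦ by rw [smul_add, map_add, ha i hi, hb i hi, add_zero]
            zero_mem' := fun i _ ↦ by rw [smul_zero, map_zero]
            smul_mem' := fun r x hx i hi ↦ by
              rw [smul_comm, map_smul, hx i hi, smul_zero] }
        have htop : (⊤ : Submodule R P) ≤ P₂ := by
          refine Submodule.le_of_le_smul_of_le_jacobson_bot (I := maximalIdeal R)
            Module.Finite.fg_top (maximalIdeal_le_jacobson _) fun p _ ↦ ?_
          obtain ⟨v₁, v₂, hv, hv₁, hv₂⟩ := (h.exists_decomposition (f (π p))).resolve_right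
            fun ⟨l, hl⟩ ↦ hsplit ⟨l ∘ₗ f, π p, hl⟩
          have hg12 : g v₁ + g v₂ = 0 := by rw [← map_add, hv, hgf]
          have hg1 : g v₁ = 0 := by
            refine h.syz_eq_zero_of_annihilate hN (fun i hi ↦ ?_) fun j hj ↦ ?_
            · rw [eq_neg_of_add_eq_zero_left hg12, smul_neg, ← map_smul, hv₂ i hi, map_zero,
                neg_zero]
            · rw [← map_smul, hv₁ j hj, map_zero]
          obtain ⟨x₁, rfl⟩ := (hfg _).1 hg1
          obtain ⟨p₁, rfl⟩ := hπ x₁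
          have hv₂' : v₂ = f (π (p - p₁)) := by
            rw [map_sub, map_sub, ← hv, add_sub_cancel_left]
          have hp₁ : ∀ j ∈ J, j • p₁ = 0 := by
            intro j hj
            have h0 : π (j • p₁) = 0 := hf (by
              rw [map_smul, map_smul, hv₁ j hj, map_zero])
            obtain ⟨r, hr⟩ := (hker _).1 h0
            refine h.proj_eq_zero_of_annihilate (fun i hi ↦ ?_) fun j' hj' ↦ ?_
            · rw [smul_smul, h.mul_eq_zero hi hj, zero_smul]
            · rw [← hr, smul_comm, (hann j').2 hj', smul_zero]
          rw [← sub_add_cancel p p₁]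
          refine Submodule.add_mem_sup ?_ (h.mem_smul_top_of_annihilate hp₁)
          intro i hi
          refine hf ?_
          rw [map_zero, map_smul, map_smul, ← hv₂', hv₂ i hi]
        intro i hi p
        exact (hker _).1 (htop (Submodule.mem_top (x := p)) i hi)
      obtain ⟨p, l, hlp⟩ : ∃ (p : P) (l : P →ₗ[R] R), l p = 1 := by
        have b := Module.finBasis R P
        rw [hrank] at b
        exact ⟨b 0, b.coord 0, by simp⟩
      have hlw : l w ∈ I := h.mem_left_of_annihilate fun j hj ↦ by
        rw [← smul_eq_mul, ← map_smul, (hann j).2 hj, map_zero]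
      have hspan : I = Ideal.span {l w} := by
        refine le_antisymm (fun i hi ↦ ?_) ((Ideal.span_singleton_le_iff_mem _).2 hlw)
        obtain ⟨r, hr⟩ := hIP i hi p
        rw [Ideal.mem_span_singleton']
        refine ⟨r, ?_⟩
        rw [← smul_eq_mul, ← map_smul, hr, map_smul, hlp, smul_eq_mul, mul_one]
      have hannl : ∀ r, r * l w = 0 ↔ r ∈ J := by
        intro r
        constructor
        · intro hr
          refine h.mem_right_of_annihilate fun i hi ↦ ?_
          rw [hspan, Ideal.mem_span_singleton'] at hi
          obtain ⟨t, rfl⟩ := hi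
          rw [mul_assoc, mul_comm _ r, hr, mul_zero]
        · intro hr
          rw [mul_comm]
          exact h.mul_eq_zero hlw hr
      -- For `q ∈ ker l`, `i • q = r • w` gives `r * l w = 0`, so `r ∈ J` and `i • q = 0`. Thus `I`
      -- kills the projective module `ker l`, which vanishes by Nakayama, and `P` has rank one.
      have hkerl : ∀ q, l q = 0 → q = 0 := by
        have hproj := projective_ker_of_apply_eq_one l p hlp
        have hfin := finite_ker_of_apply_eq_one l p hlp
        have hI0 : ∀ i ∈ I, ∀ q : LinearMap.ker l, i • q = 0 := by
          rintro i hi ⟨q, hq⟩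
          obtain ⟨r, hr⟩ := hIP i hi q
          have hr0 : r * l w = 0 := by
            rw [← smul_eq_mul, ← map_smul, hr, map_smul, LinearMap.mem_ker.1 hq, smul_zero]
          refine Subtype.ext ?_
          rw [Submodule.coe_smul, ← hr, (hann r).2 ((hannl r).1 hr0), Submodule.coe_zero]
        have hbot : (⊤ : Submodule R (LinearMap.ker l)) = ⊥ :=
          Submodule.eq_bot_of_le_smul_of_le_jacobson_bot (maximalIdeal R) _ Module.Finite.fg_top
            (fun q _ ↦ h.symm.mem_smul_top_of_annihilate fun i hi ↦ hI0 i hi q)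
            (maximalIdeal_le_jacobson _)
        intro q hq
        have : (⟨q, hq⟩ : LinearMap.ker l) ∈ (⊥ : Submodule R _) := hbot ▸ Submodule.mem_top
        exact congrArg Subtype.val ((Submodule.mem_bot R).1 this)
      have hp : ∀ q, q = l q • p := by
        intro q
        rw [← sub_eq_zero]
        refine hkerl _ ?_
        rw [map_sub, map_smul, hlp, smul_eq_mul, mul_one, sub_self]
      let θ : R →ₗ[R] L := LinearMap.toSpanSingleton R L (π p)
      have hθ : Function.Surjective θ := by
        intro x
        obtain ⟨q, rfl⟩ := hπ x
        refine ⟨l q, ?_⟩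
        rw [LinearMap.toSpanSingleton_apply, ← map_smul, ← hp]
      have hkθ : LinearMap.ker θ = I := by
        ext r
        rw [LinearMap.mem_ker, LinearMap.toSpanSingleton_apply, ← map_smul, hker, hspan,
          Ideal.mem_span_singleton']
        refine exists_congr fun t ↦ ⟨fun ht ↦ ?_, fun ht ↦ ?_⟩
        · rw [← smul_eq_mul, ← map_smul, ht, map_smul, hlp, smul_eq_mul, mul_one]
        · rw [← ht, mul_smul, ← hp]
      exact ⟨l w, hspan, hannl, hL.of_equiv
        ((Submodule.quotEquivOfEq _ _ hkθ).symm ≪≫ₗ θ.quotKerEquivOfSurjective hθ).symm⟩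

/-- An embedding of `R ⧸ J` in `P` is determined by the image of `1`, an element with annihilator
`J`. -/
lemma exists_generator_of_syz_quotient {n : ℕ}
    (hJ : Syz R (n + 3) (ModuleCat.of R (R ⧸ J))) :
    ∃ z : R, I = Ideal.span {z} ∧ (∀ r, r * z = 0 ↔ r ∈ J) ∧
      Syz R (n + 2) (ModuleCat.of R (R ⧸ I)) := by
  obtain ⟨P, L, _, _, _, _, f, g, _, _, hL, hf, hfg, hg⟩ := hJ.succ_elim
  have hf1 : ∀ r : R, f (Submodule.Quotient.mk r) = r • f (Submodule.Quotient.mk 1) := by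
    intro r
    rw [← map_smul, ← Submodule.Quotient.mk_smul, smul_eq_mul, mul_one]
  refine h.exists_generator_of_syz_cyclic_quotient _ P L g (f (Submodule.Quotient.mk 1)) rfl hg
    (fun p ↦ ?_) (fun r ↦ ?_) hL
  · rw [hfg p]
    constructor
    · rintro ⟨x, rfl⟩
      obtain ⟨r, rfl⟩ := Submodule.Quotient.mk_surjective J x
      exact ⟨r, (hf1 r).symm⟩
    · rintro ⟨r, rfl⟩
      exact ⟨Submodule.Quotient.mk r, hf1 r⟩
  · rw [← hf1, map_eq_zero_iff f hf, Submodule.Quotient.mk_eq_zero]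

lemma not_closedUnderDirectSummands (hd : 2 ≤ moduleDepth R (R ⧸ I)) {n : ℕ} (hn : 4 ≤ n) :
    ¬ ClosedUnderDirectSummands R (Syz R n) := by
  intro hclosed
  obtain ⟨hIn, hJn⟩ := IsSummandOfSyz.of_two_le h.left_ne h.right_ne h.sup_eq h.inf_eq
    ⟨PUnit, _, _, h.syz_two_left.of_equiv LinearEquiv.prodUnique.symm⟩
    ⟨PUnit, _, _, h.symm.syz_two_left.of_equiv LinearEquiv.prodUnique.symm⟩
    ((by norm_num : 2 ≤ 4).trans hn)
  have hI4 := (hIn.syz hclosed).of_le hn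
  have hJ4 := (hJn.syz hclosed).of_le hn
  obtain ⟨a, ha, b, hb, hreg, hreg'⟩ := exists_regular_pair_of_two_le_moduleDepth h.sup_eq hd
  obtain ⟨z, hz, hannz, -⟩ := h.exists_generator_of_syz_quotient (n := 0)
    (h.syz_quotient_of_syz (fun φ ↦ exists_eq_mul_of_regular_pair h.inf_eq ha hb hreg hreg'
      (fun _ hr ↦ h.mem_right_of_annihilate hr) φ) hJ4)
  have e : I ≃ₗ[R] R ⧸ J := by
    have hzI : z ∈ I := hz ▸ Ideal.mem_span_singleton_self z
    let θ : R →ₗ[R] I := LinearMap.toSpanSingleton R I ⟨z, hzI⟩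
    have hθ : Function.Surjective θ := by
      rintro ⟨i, hi⟩
      have hi' := hi
      rw [hz, Ideal.mem_span_singleton'] at hi'
      obtain ⟨r, rfl⟩ := hi'
      exact ⟨r, rfl⟩
    have hkθ : LinearMap.ker θ = J := by
      ext r
      rw [LinearMap.mem_ker, ← hannz r, ← Subtype.coe_inj]
      rfl
    exact ((Submodule.quotEquivOfEq _ _ hkθ).symm ≪≫ₗ θ.quotKerEquivOfSurjective hθ).symm
  -- The index four is needed here: going from `R ⧸ J` to `R ⧸ I` costs one step, and a third syzygy
  -- is required to conclude that `J` is principal.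
  obtain ⟨-, -, -, hRI⟩ := h.exists_generator_of_syz_quotient (n := 1) (hI4.of_equiv e)
  obtain ⟨y, hy, -, -⟩ := h.symm.exists_generator_of_syz_quotient (n := 0) hRI
  rw [hy, Ideal.mem_span_singleton'] at ha hb
  obtain ⟨α, hα⟩ := ha
  obtain ⟨β, hβ⟩ := hb
  -- Both `a = α * y` and `b = β * y` are multiples of `y`, so `b * α = a * β` and `α ≡ a * t`
  -- modulo `I`. Multiplying by `y` gives `a = a * t * y`, whence `a = 0`, which is not regular on
  -- `R ⧸ I`.
  obtain ⟨t, ht⟩ := hreg' α β (by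
    rw [show b * α - a * β = 0 by rw [← hα, ← hβ]; ring]; exact I.zero_mem)
  have hyJ : y ∈ J := hy ▸ Ideal.mem_span_singleton_self y
  have hat : a * (1 - t * y) = 0 := by
    have := h.mul_eq_zero ht hyJ
    linear_combination this - hα
  have hu : IsUnit (1 - t * y) := (isUnit_or_isUnit_one_sub_self (t * y)).resolve_left
    ((mem_maximalIdeal _).1 (h.right_le (J.mul_mem_left t hyJ)))
  have h1 : (1 : R) ∈ I := hreg 1 (by
    rw [hu.mul_left_eq_zero.1 hat, zero_mul]; exact I.zero_mem)
  exact (maximalIdeal.isMaximal R).ne_top ((Ideal.eq_top_iff_one _).2 (h.left_le h1))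

end IsSaturatedSplitting

/-! ### The theorem, by cases on the depth of `R ⧸ J` in (2). -/

theorem proposition4p8 (R : Type u) [CommRing R] [IsNoetherianRing R] [IsLocalRing R]
    (I J : Ideal R) (hI : I ≠ ⊥) (hJ : J ≠ ⊥)
    (hsum : I ⊔ J = IsLocalRing.maximalIdeal R) (hinf : I ⊓ J = ⊥) :
    (moduleDepth R (R ⧸ I) = 0 → 1 ≤ moduleDepth R (R ⧸ J) →
      moduleDepth R R = 0 ∧ ∀ n : ℕ, 2 ≤ n → ¬ ClosedUnderDirectSummands R (Syz R n)) ∧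
    (Indecomposable (ModuleCat.of R I) → 2 ≤ moduleDepth R (R ⧸ I) →
      moduleDepth R R ≤ 1 ∧ ∀ n : ℕ, 4 ≤ n → ¬ ClosedUnderDirectSummands R (Syz R n)) := by
  refine ⟨fun h₁ h₂ ↦ moduleDepth_eq_zero_and_not_closed hI hJ hsum hinf h₁ h₂,
    fun _ hd ↦ ⟨moduleDepth_le_one_of_maximalIdeal_eq_sup hI hJ hsum hinf, fun n hn ↦ ?_⟩⟩
  have hdI : 1 ≤ moduleDepth R (R ⧸ I) := le_trans (by norm_num) hd
  by_cases hdJ : moduleDepth R (R ⧸ J) = 0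
  · exact (moduleDepth_eq_zero_and_not_closed hJ hI (sup_comm I J ▸ hsum) (inf_comm I J ▸ hinf)
      hdJ hdI).2 n ((by norm_num : 2 ≤ 4).trans hn)
  · exact IsSaturatedSplitting.not_closedUnderDirectSummands
      ⟨hsum, hinf, Ideal.isMaxSaturated_of_one_le_moduleDepth hdI,
        Ideal.isMaxSaturated_of_one_le_moduleDepth (Order.one_le_iff_ne_zero.2 hdJ), hI, hJ⟩ hd hn
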